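/- **Definitions.** Let $G$ be a group. A $G$-set $M$ is *connected* if there is a connected $G$-invariant simple graph with vertex set $M$ whose edges form finitely many $G$-orbits. A *divider* on $M$ is a symmetric set $\mathbf u\subseteq M\times M$ containing the diagonal such that, for some finite $F\subseteq G$, the composition square of $\bigcap_{f\in F}f\mathbf u$ is contained in $\mathbf u$. It is *perspective* if for every pair $\beta\in M\times M$ the set $\{g\in G: g\beta\notin\mathbf u\}$ is finite. A *relative hyperbolicity* on $M$ is a uniformity $\mathcal U$ on $M$ that is generated, as a $G$-invariant filter, by a perspective divider (i.e. $\mathcal U$ is the filter generated by the sets $g\mathbf u$, $g\in G$), and whose boundary $\overline M\setminus\iota(M)$ has at least two points, where $\iota:M\to\overline M$ is the canonical map to the Hausdorff completion of $(M,\mathcal U)$. Let $G$ act by homeomorphisms on a compact Hausdorff space $T$. For $r,a\in T$, the pair $(r,a)$ is the centre of a *limit cross* if for all neighbourhoods $R$ of $r$ and $A$ of $a$ there are infinitely many $g\in G$ with $g(T\setminus R)\subseteq A$; then $a$ is called a *limit point*. For $n\ge 2$ let $\Theta^nT$ be the space of $n$-tuples of pairwise distinct points of $T$, with the topology induced from $T^n$.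 The action of the discrete group $G$ on $T$ is *relatively hyperbolic* (in the dynamical sense) if * it is proper on triples: for all compact $K,L\subseteq\Theta^3T$ the set $\{g\in G: gK\cap L\neq\varnothing\}$ is finite; * it is cocompact on pairs: there is a compact $K\subseteq\Theta^2T$ with $\bigcup_{g\in G}gK=\Theta^2T$; * it has at least two limit points. **Proposition ($\mathrm{RH_{pd}}\Rightarrow\mathrm{RH_{32}}$).** Let $\mathcal U$ be a relative hyperbolicity on a connected $G$-set $M$. Then $G$ acts on $(M,\mathcal U)$ by uniformly continuous maps, the completion $\overline M$ of $M$ with respect to $\mathcal U$ is a compact Hausdorff space, and the induced action of $G$ on $\overline M$ is relatively hyperbolic in the dynamical sense. -/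

import Mathlib

open Set Filter Topology Uniformity
open scoped Pointwise

namespace RelHyp

/-- A `G`-set `M` is connected if it is the vertex set of a connected graph which is preserved by
`G` and whose edges fall into finitely many `G`-orbits. -/
def IsConnectedGSet (G M : Type*) [Group G] [MulAction G M] : Prop :=
  ∃ Γ : SimpleGraph M, Γ.Connected ∧
    (∀ (g : G) (x y : M), Γ.Adj x y → Γ.Adj (g • x) (g • y)) ∧
    ∃ E : Set (Sym2 M), E.Finite ∧
      ∀ e ∈ Γ.edgeSet, ∃ e' ∈ E, ∃ g : G, e = Sym2.map (fun x => g • x) e'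

/-- A divider on a `G`-set `M`: a symmetric reflexive relation `u` on `M` such that, for some
finite `F ⊆ G`, the composition square of the intersection of the translates `f • u`, `f ∈ F`,
is contained in `u`. -/
structure IsDivider (G : Type*) {M : Type*} [Group G] [MulAction G M] (u : Set (M × M)) :
    Prop where
  refl : ∀ x : M, (x, x) ∈ u
  symm : ∀ x y : M, (x, y) ∈ u → (y, x) ∈ u
  exists_finite : ∃ F : Set G, F.Finite ∧
    ∀ x y z : M, (x, y) ∈ ⋂ f ∈ F, f • u → (y, z) ∈ ⋂ f ∈ F, f • u → (x, z) ∈ u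

/-- A relation `u` is perspective if, for every pair of points, all but finitely many elements
of `G` move this pair into `u`. -/
def IsPerspective (G : Type*) {M : Type*} [Group G] [MulAction G M] (u : Set (M × M)) : Prop :=
  ∀ β : M × M, {g : G | g • β ∉ u}.Finite

/-- The boundary of a uniform space: the points of the (Hausdorff) completion which do not come
from points of the space. -/
def boundary (M : Type*) [UniformSpace M] : Set (UniformSpace.Completion M) :=
  (range ((↑) : M → UniformSpace.Completion M))ᶜ

/-- The uniformity of `M` is a relative hyperbolicity: it is the `G`-invariant filter generated by
a perspective divider, and it is not parabolic, that is, its boundary has at least two points. -/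
structure IsRelativeHyperbolicity (G M : Type*) [Group G] [MulAction G M] [UniformSpace M] :
    Prop where
  exists_divider : ∃ u : Set (M × M), IsDivider G u ∧ IsPerspective G u ∧
    𝓤 M = ⨅ g : G, 𝓟 (g • u)
  not_parabolic : (boundary M).Nontrivial

/-- The space of `n`-tuples of pairwise distinct points of `T`, as an invariant subset of the
`n`-th power of `T`. -/
def distinctTuples (G T : Type*) [Group G] [MulAction G T] (n : ℕ) :
    SubMulAction G (Fin n → T) where
  carrier := {t | Function.Injective t}
  smul_mem' := fun g _ ht => (MulAction.injective g).comp ht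

/-- `(r, a)` is the centre of a limit cross `{r} × T ∪ T × {a}` of the action: for all
neighbourhoods `R` of `r` and `A` of `a`, infinitely many elements of `G` map the complement
of `R` into `A`. -/
def IsLimitCross (G : Type*) {T : Type*} [Group G] [MulAction G T] [TopologicalSpace T]
    (r a : T) : Prop :=
  ∀ R ∈ 𝓝 r, ∀ A ∈ 𝓝 a, {g : G | ∀ x ∉ R, g • x ∈ A}.Infinite

/-- The limit set: the attracting points of the limit crosses. -/
def limitSet (G T : Type*) [Group G] [MulAction G T] [TopologicalSpace T] : Set T :=
  {a | ∃ r : T, IsLimitCross G r a}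

/-- A relatively hyperbolic action, in the dynamical sense, of a discrete group `G` on `T`: an
action by homeomorphisms on a compact Hausdorff space, proper on triples of distinct points,
cocompact on pairs of distinct points, and with at least two limit points. -/
structure IsRelativelyHyperbolicAction (G T : Type*) [Group G] [MulAction G T]
    [TopologicalSpace T] : Prop where
  compactSpace : CompactSpace T
  t2Space : T2Space T
  continuousConstSMul : ContinuousConstSMul G T
  proper_on_triples : ProperlyDiscontinuousSMul G (distinctTuples G T 3)
  cocompact_on_pairs : ∃ K : Set (distinctTuples G T 2), IsCompact K ∧ ⋃ g : G, g • K = univ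
  two_limit_points : (limitSet G T).Nontrivial

end RelHyp

/-! The core is a visibility property: a geodesic avoiding a suitable finite set of edges has its
endpoints in the divider `u`. Shrinking `u` repeatedly by one finite set of group elements gives
relations `u n` such that the threefold composite of `u (n + 1)` lies in `u n`. Perspectivity leaves
finitely many edges outside `u`, and each shrinking moves them by a bounded distance, so the edges
outside `u n` lie in a ball of radius linear in `n`. A geodesic meets only linearly many of them. As
the series of `n * 2⁻¹ ^ n` converges, the chain lemma `mem_of_sum_lt` applies once the finitely
many edges outside some `u N` are avoided (`IsDivider.exists_isVisibleOff`).

Visibility makes `M` totally bounded and, with perspectivity, yields the convergence property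
(`HasVisibility.finite_not_convergence`), which extends to the compact completion by density. There
it gives properness on triples by pigeonhole and makes boundary points limit points. Cocompactness
on pairs reflects that the translates of `u` generate the uniformity, hence separate points. -/

namespace RelHyp

/-! ### Geodesics, the chain lemma and visibility from linear growth -/

section Geodesics

variable {M : Type*}

/-- The sequence of vertices `p` is a geodesic of the graph `Γ` between the times `a` and `b`. -/
def IsGeodesicOn (Γ : SimpleGraph M) (p : ℕ → M) (a b : ℕ) : Prop :=
  ∀ i j, a ≤ i → i ≤ j → j ≤ b → i + Γ.dist (p i) (p j) = j

lemma IsGeodesicOn.mono {Γ : SimpleGraph M} {p : ℕ → M} {a b c d : ℕ}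
    (h : IsGeodesicOn Γ p a b) (hac : a ≤ c) (hdb : d ≤ b) : IsGeodesicOn Γ p c d :=
  fun i j hi hij hj => h i j (hac.trans hi) hij (hj.trans hdb)

lemma IsGeodesicOn.adj {Γ : SimpleGraph M} {p : ℕ → M} {a b i : ℕ}
    (h : IsGeodesicOn Γ p a b) (hi : a ≤ i) (hib : i < b) : Γ.Adj (p i) (p (i + 1)) := by
  have := h i (i + 1) hi (Nat.le_succ i) hib
  exact SimpleGraph.dist_eq_one_iff_adj.1 (by omega)

lemma exists_isGeodesicOn {Γ : SimpleGraph M} (hΓ : Γ.Connected) (x y : M) :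
    ∃ (p : ℕ → M) (n : ℕ), IsGeodesicOn Γ p 0 n ∧ p 0 = x ∧ p n = y := by
  obtain ⟨w, hw⟩ := hΓ.exists_walk_length_eq_dist x y
  have key : ∀ i k, i + k ≤ w.length → Γ.dist (w.getVert i) (w.getVert (i + k)) ≤ k := by
    intro i k
    induction k with
    | zero => simp
    | succ k ih =>
      intro hk
      have h1 := SimpleGraph.dist_eq_one_iff_adj.2 (w.adj_getVert_succ (i := i + k) (by omega))
      have h2 := hΓ.dist_triangle (u := w.getVert i) (v := w.getVert (i + k))
        (w := w.getVert (i + k + 1))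
      have h3 := ih (by omega)
      rw [← add_assoc]
      omega
  refine ⟨w.getVert, w.length, fun i j _ hij hj => ?_, w.getVert_zero, w.getVert_length⟩
  have h1 := key 0 i (by omega)
  have h2 := key i (j - i) (by omega)
  have h3 := key j (w.length - j) (by omega)
  rw [zero_add, w.getVert_zero] at h1
  rw [Nat.add_sub_cancel' hij] at h2
  rw [Nat.add_sub_cancel' hj, w.getVert_length] at h3
  have h4 := hΓ.dist_triangle (u := x) (v := w.getVert i) (w := y)
  have h5 := hΓ.dist_triangle (u := w.getVert i) (v := w.getVert j) (w := y)
  omega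

/-- The edges in `A` block the view outside `v`: every pair of points joined by a geodesic which
avoids the (oriented) edges in `A` belongs to `v`. -/
def IsVisibleOff (Γ : SimpleGraph M) (v A : Set (M × M)) : Prop :=
  ∀ (p : ℕ → M) (a b : ℕ), a ≤ b → IsGeodesicOn Γ p a b →
    (∀ i, a ≤ i → i < b → (p i, p (i + 1)) ∉ A) → (p a, p b) ∈ v

/-- A geodesic from `x` towards `y`, followed until it meets an edge in `A`. -/
lemma exists_isGeodesicOn_avoiding {Γ : SimpleGraph M} (hΓ : Γ.Connected) (A : Set (M × M))
    (x y : M) :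
    ∃ (p : ℕ → M) (c : ℕ), IsGeodesicOn Γ p 0 c ∧ p 0 = x ∧ p c ∈ insert y (Prod.fst '' A) ∧
      ∀ i < c, (p i, p (i + 1)) ∉ A := by
  classical
  obtain ⟨p, n, hp, h0, hn⟩ := exists_isGeodesicOn hΓ x y
  have hex : ∃ i, i = n ∨ (p i, p (i + 1)) ∈ A := ⟨n, Or.inl rfl⟩
  refine ⟨p, Nat.find hex, hp.mono le_rfl (Nat.find_min' hex (Or.inl rfl)), h0, ?_, fun i hi hA =>
    Nat.find_min hex hi (Or.inr hA)⟩
  rcases Nat.find_spec hex with h | h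
  · exact Or.inl (by rw [h, hn])
  · exact Or.inr ⟨_, h, rfl⟩

/-- A chain lemma in the spirit of Frink: steps of small total weight stay in a small relation. -/
lemma mem_of_sum_lt {u : ℕ → Set (M × M)} (hrefl : ∀ n x, (x, x) ∈ u n)
    (hcomp : ∀ n x y z t, (x, y) ∈ u (n + 1) → (y, z) ∈ u (n + 1) → (z, t) ∈ u (n + 1) →
      (x, t) ∈ u n)
    (p : ℕ → M) (w : ℕ → ENNReal) {a b : ℕ} (hab : a ≤ b)
    (hw : ∀ i, a ≤ i → i < b → ∀ n, w i < 2⁻¹ ^ n → (p i, p (i + 1)) ∈ u n) (n : ℕ)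
    (hsum : ∑ i ∈ Finset.Ico a b, w i < 2⁻¹ ^ (n + 1)) : (p a, p b) ∈ u n := by
  classical
  induction hk : b - a using Nat.strong_induction_on generalizing a b n with
  | _ k ih =>
  rcases hab.eq_or_lt with rfl | hlt
  · exact hrefl n _
  -- Cut at the last time `c` before which less than half of the bound is used. Both outer pieces
  -- then weigh less than `2⁻¹ ^ (n + 2)`, and the single step at `c` is controlled by the whole
  -- sum.
  let P : ℕ → Prop := fun c => a ≤ c ∧ ∑ i ∈ Finset.Ico a c, w i < 2⁻¹ ^ (n + 2)
  have hPa : P a := by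
    refine ⟨le_rfl, ?_⟩
    simp [ENNReal.pow_pos]
  set c := Nat.findGreatest P (b - 1) with hc
  obtain ⟨hac, hcs⟩ : P c := Nat.findGreatest_spec (P := P) (by omega : a ≤ b - 1) hPa
  have hcb : c ≤ b - 1 := Nat.findGreatest_le _
  have hsplit : ∑ i ∈ Finset.Ico a (c + 1), w i + ∑ i ∈ Finset.Ico (c + 1) b, w i
      = ∑ i ∈ Finset.Ico a b, w i := Finset.sum_Ico_consecutive _ (by omega) (by omega)
  have hrest : ∑ i ∈ Finset.Ico (c + 1) b, w i < 2⁻¹ ^ (n + 2) := by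
    rcases hcb.eq_or_lt with h | h
    · rw [Finset.Ico_eq_empty (by omega)]
      simp [ENNReal.pow_pos]
    · by_contra! hge
      have h1 : ¬ P (c + 1) := Nat.findGreatest_is_greatest (P := P) (Nat.lt_succ_self c) h
      have h2 : (2⁻¹ : ENNReal) ^ (n + 2) ≤ ∑ i ∈ Finset.Ico a (c + 1), w i := by
        by_contra! h3
        exact h1 ⟨by omega, h3⟩
      have h4 := add_le_add h2 hge
      rw [hsplit, pow_succ, ← mul_add, ENNReal.inv_two_add_inv_two, mul_one] at h4
      exact absurd hsum (not_lt.2 h4)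
  have hmid : w c < 2⁻¹ ^ (n + 1) :=
    (Finset.single_le_sum (f := w) (fun _ _ => zero_le)
      (Finset.mem_Ico.2 ⟨hac, by omega⟩)).trans_lt hsum
  exact hcomp n _ (p c) (p (c + 1)) _
    (ih (c - a) (by omega) hac (fun i hi hic => hw i hi (by omega)) (n + 1) hcs rfl)
    (hw c hac (by omega) _ hmid)
    (ih (b - (c + 1)) (by omega) (by omega) (fun i hi hic => hw i (by omega) hic) (n + 1) hrest rfl)

/-- If the edges outside `u n` are pairwise at distance at most linear in `n`, then geodesics all
of whose edges belong to some fixed `u N` have their endpoints in `u 0`. -/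
lemma exists_isVisibleOff_of_linear {Γ : SimpleGraph M} {u : ℕ → Set (M × M)}
    (hanti : ∀ n, u (n + 1) ⊆ u n) (hrefl : ∀ n x, (x, x) ∈ u n)
    (hcomp : ∀ n x y z t, (x, y) ∈ u (n + 1) → (y, z) ∈ u (n + 1) → (z, t) ∈ u (n + 1) →
      (x, t) ∈ u n) (C D : ℕ)
    (hlin : ∀ n x y x' y', Γ.Adj x y → Γ.Adj x' y' → (x, y) ∉ u n → (x', y') ∉ u n →
      Γ.dist x x' ≤ C * n + D) :
    ∃ N, IsVisibleOff Γ (u 0) {e | Γ.Adj e.1 e.2 ∧ e ∉ u N} := by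
  classical
  have hanti' : Antitone u := antitone_nat_of_succ_le hanti
  let f : ℕ → ENNReal := fun n => ((C * n + D + 1 : ℕ) : ENNReal) * 2⁻¹ ^ n
  have hf : ∑' n, f n ≠ ⊤ := by
    have h1 : Summable fun n : ℕ => ((C * n + D + 1 : ℕ) : ℝ) * (2⁻¹ : ℝ) ^ n := by
      have ha := (summable_pow_mul_geometric_of_norm_lt_one 1
        (r := (2⁻¹ : ℝ)) (by norm_num)).mul_left (C : ℝ)
      have hb := (summable_geometric_of_lt_one (r := (2⁻¹ : ℝ)) (by norm_num)
        (by norm_num)).mul_left ((D : ℝ) + 1)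
      refine (ha.add hb).congr fun n => ?_
      push_cast
      ring
    have h2 : f = fun n => ENNReal.ofReal (((C * n + D + 1 : ℕ) : ℝ) * (2⁻¹ : ℝ) ^ n) := by
      funext n
      rw [ENNReal.ofReal_mul (Nat.cast_nonneg _), ENNReal.ofReal_natCast,
        ENNReal.ofReal_pow (by norm_num), ENNReal.ofReal_inv_of_pos (by norm_num)]
      simp [f]
    rw [h2]
    exact h1.tsum_ofReal_ne_top
  obtain ⟨N, hN⟩ : ∃ N, ∑' n, f (n + N) < 2⁻¹ ^ (0 + 1) :=
    ((ENNReal.tendsto_sum_nat_add f hf).eventually_lt_const (by simp)).exists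
  refine ⟨N, fun p a b hab hp havoid => ?_⟩
  have hlevel : ∀ i, a ≤ i → i < b → (p i, p (i + 1)) ∈ u N := fun i hi hib => by
    by_contra h
    exact havoid i hi hib ⟨hp.adj hi hib, h⟩
  -- An edge outside `u (n + N)` has weight at least `2⁻¹ ^ (n + N)`. Exchanging the sums counts,
  -- for each level, the edges of the geodesic outside it.
  let w : ℕ → ENNReal := fun i =>
    ∑' n, if (p i, p (i + 1)) ∈ u (n + N) then 0 else 2⁻¹ ^ (n + N)
  refine mem_of_sum_lt hrefl hcomp p w hab (fun i hi hib n hwn => ?_) 0 (lt_of_le_of_lt ?_ hN)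
  · by_contra hn
    have hNn : N ≤ n := by
      by_contra! h
      exact hn (hanti' h.le (hlevel i hi hib))
    obtain ⟨k, rfl⟩ := Nat.exists_eq_add_of_le' hNn
    refine absurd hwn (not_lt.2 ?_)
    have := ENNReal.le_tsum (f := fun n =>
      if (p i, p (i + 1)) ∈ u (n + N) then (0 : ENNReal) else 2⁻¹ ^ (n + N)) k
    rwa [if_neg hn] at this
  · rw [← Summable.tsum_finsetSum fun _ _ => ENNReal.summable]
    refine ENNReal.tsum_le_tsum fun n => ?_
    rw [Finset.sum_ite, Finset.sum_const_zero, zero_add, Finset.sum_const, nsmul_eq_mul]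
    refine mul_le_mul_left (Nat.cast_le.2 ?_) _
    set s := (Finset.Ico a b).filter fun i => (p i, p (i + 1)) ∉ u (n + N) with hs
    rcases s.eq_empty_or_nonempty with h0 | hne
    · simp [h0]
    -- Times along a geodesic differ by distances, so the bad times at one level fit in an interval
    -- of length `C * (n + N) + D`.
    have hsub : s ⊆ Finset.Icc (s.min' hne) (s.min' hne + (C * (n + N) + D)) := by
      intro j hj
      have hmj := s.min'_le j hj
      have hm := s.min'_mem hne
      set m := s.min' hne
      obtain ⟨hm1, hm2⟩ := Finset.mem_filter.1 hm
      obtain ⟨hj1, hj2⟩ := Finset.mem_filter.1 hj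
      rw [Finset.mem_Ico] at hm1 hj1
      have h1 := hlin _ _ _ _ _ (hp.adj hm1.1 hm1.2) (hp.adj hj1.1 hj1.2) hm2 hj2
      have h2 := hp m j hm1.1 hmj hj1.2.le
      rw [Finset.mem_Icc]
      omega
    refine (Finset.card_le_card hsub).trans ?_
    rw [Nat.card_Icc]
    omega

end Geodesics

/-! ### Iterated shrinking of a divider -/

section Dividers

variable {G M : Type*} [Group G] [MulAction G M]

lemma mem_smul_rel {g : G} {u : Set (M × M)} {x y : M} :
    (x, y) ∈ g • u ↔ (g⁻¹ • x, g⁻¹ • y) ∈ u := by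
  rw [mem_smul_set_iff_inv_smul_mem, Prod.smul_mk]

/-- Oriented edges of a graph whose edges form finitely many orbits form finitely many orbits. -/
lemma exists_finite_orbit_reps {Γ : SimpleGraph M}
    (hE : ∃ E : Set (Sym2 M), E.Finite ∧
      ∀ e ∈ Γ.edgeSet, ∃ e' ∈ E, ∃ g : G, e = Sym2.map (fun x => g • x) e') :
    ∃ P : Set (M × M), P.Finite ∧ ∀ x y, Γ.Adj x y → ∃ e ∈ P, ∃ g : G, (x, y) = g • e := by
  obtain ⟨E, hE, h⟩ := hE
  refine ⟨(fun q : M × M => s(q.1, q.2)) ⁻¹' E, hE.preimage' fun e _ => ?_, fun x y hxy => ?_⟩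
  · induction e with
    | _ a b =>
      refine (Set.toFinite {(a, b), (b, a)}).subset fun q hq => ?_
      obtain ⟨c, d⟩ := q
      have : s(c, d) = s(a, b) := hq
      rcases Sym2.eq_iff.1 this with ⟨rfl, rfl⟩ | ⟨rfl, rfl⟩ <;> simp
  · obtain ⟨e', he', g, hg⟩ := h s(x, y) hxy
    induction e' with
    | _ a b =>
      rw [Sym2.map_mk] at hg
      rcases Sym2.eq_iff.1 hg with ⟨h1, h2⟩ | ⟨h1, h2⟩
      · exact ⟨(a, b), he', g, by rw [h1, h2, Prod.smul_mk]⟩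
      · refine ⟨(b, a), ?_, g, by rw [h1, h2, Prod.smul_mk]⟩
        change s(b, a) ∈ E
        rwa [Sym2.eq_swap]

/-- Vertices of a connected graph with finitely many orbits of edges form finitely many orbits. -/
lemma exists_finite_vertex_reps {Γ : SimpleGraph M} (hΓ : Γ.Connected) {P : Set (M × M)}
    (hP : P.Finite) (hE : ∀ x y, Γ.Adj x y → ∃ e ∈ P, ∃ g : G, (x, y) = g • e) :
    ∃ V : Set M, V.Finite ∧ ∀ x : M, ∃ o ∈ V, ∃ g : G, x = g • o := by
  obtain ⟨o⟩ := hΓ.nonempty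
  -- The extra vertex `o` covers the case of a single vertex, where there are no edges.
  refine ⟨insert o (Prod.fst '' P), (hP.image _).insert o, fun x => ?_⟩
  by_cases hx : x = o
  · exact ⟨o, mem_insert _ _, 1, by simp [hx]⟩
  · have : Nontrivial M := ⟨x, o, hx⟩
    obtain ⟨y, hxy⟩ := hΓ.preconnected.exists_adj_of_nontrivial x
    obtain ⟨e, he, g, hg⟩ := hE x y hxy
    exact ⟨e.1, Or.inr ⟨e, he, rfl⟩, g, congrArg Prod.fst hg⟩

lemma IsPerspective.finite_edges {Γ : SimpleGraph M} {v P : Set (M × M)}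
    (hv : IsPerspective G v) (hP : P.Finite)
    (hE : ∀ x y, Γ.Adj x y → ∃ e ∈ P, ∃ g : G, (x, y) = g • e) :
    {e : M × M | Γ.Adj e.1 e.2 ∧ e ∉ v}.Finite := by
  refine (hP.biUnion fun e _ => (hv e).image fun g : G => g • e).subset ?_
  rintro ⟨x, y⟩ ⟨hadj, hnot⟩
  obtain ⟨e, he, g, hg⟩ := hE x y hadj
  refine mem_biUnion he ⟨g, ?_, hg.symm⟩
  change g • e ∉ v
  rwa [← hg]

/-- The decreasing sequence of relations obtained from `u` by repeatedly intersecting the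
translates by the inverses of the elements of `S`. -/
def shrink (S : Set G) (u : Set (M × M)) : ℕ → Set (M × M)
  | 0 => u
  | n + 1 => {e | ∀ s ∈ S, s • e ∈ shrink S u n}

lemma shrink_refl {S : Set G} {u : Set (M × M)} (hu : ∀ x, (x, x) ∈ u) (n : ℕ) (x : M) :
    (x, x) ∈ shrink S u n := by
  induction n generalizing x with
  | zero => exact hu x
  | succ n ih => exact fun s _ => ih _

lemma shrink_succ_subset {S : Set G} (hS : 1 ∈ S) (u : Set (M × M)) (n : ℕ) :
    shrink S u (n + 1) ⊆ shrink S u n := fun e he => by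
  simpa using he 1 hS

lemma shrink_comp {S : Set G} {u : Set (M × M)}
    (hu : ∀ x y z t, (x, y) ∈ shrink S u 1 → (y, z) ∈ shrink S u 1 → (z, t) ∈ shrink S u 1 →
      (x, t) ∈ u) (n : ℕ) :
    ∀ x y z t, (x, y) ∈ shrink S u (n + 1) → (y, z) ∈ shrink S u (n + 1) →
      (z, t) ∈ shrink S u (n + 1) → (x, t) ∈ shrink S u n := by
  induction n with
  | zero => exact hu
  | succ n ih => exact fun x y z t h1 h2 h3 s hs => ih _ _ _ _ (h1 s hs) (h2 s hs) (h3 s hs)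

/-- Applying the divider condition twice bounds a threefold composite, at the cost of replacing the
finite set by its product with itself. Inverses enter because `shrink` moves pairs rather than
relations. -/
lemma IsDivider.exists_shrink_comp {u : Set (M × M)} (hu : IsDivider G u) :
    ∃ S : Set G, S.Finite ∧ 1 ∈ S ∧ ∀ x y z t, (x, y) ∈ shrink S u 1 → (y, z) ∈ shrink S u 1 →
      (z, t) ∈ shrink S u 1 → (x, t) ∈ u := by
  obtain ⟨F, hF, hcomp⟩ := hu.exists_finite
  set F' : Set G := insert 1 F⁻¹ with hF'
  have hF'fin : F'.Finite := hF.inv.insert 1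
  have h1 : (1 : G) ∈ F' := mem_insert _ _
  have key : ∀ x y z, (∀ f ∈ F', (f • x, f • y) ∈ u) → (∀ f ∈ F', (f • y, f • z) ∈ u) →
      (x, z) ∈ u := by
    refine fun x y z hxy hyz => hcomp x y z ?_ ?_ <;> refine mem_iInter₂.2 fun f hf => ?_ <;>
      rw [mem_smul_rel]
    · exact hxy _ (Or.inr (inv_mem_inv.2 hf))
    · exact hyz _ (Or.inr (inv_mem_inv.2 hf))
  refine ⟨F' * F', hF'fin.mul hF'fin, ⟨1, h1, 1, h1, mul_one 1⟩, fun x y z t hxy hyz hzt => ?_⟩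
  have sub : ∀ {a b}, (a, b) ∈ shrink (F' * F') u 1 → ∀ f ∈ F', ∀ f' ∈ F',
      (f • f' • a, f • f' • b) ∈ u := fun h f hf f' hf' => by
    have := h (f * f') ⟨f, hf, f', hf', rfl⟩
    rwa [Prod.smul_mk, mul_smul, mul_smul] at this
  refine key x z t (fun f hf => key _ (f • y) _ ?_ ?_) fun f hf => ?_
  · exact fun f' hf' => sub hxy f' hf' f hf
  · exact fun f' hf' => sub hyz f' hf' f hf
  · simpa using sub hzt f hf 1 h1

lemma isPerspective_shrink {S : Set G} (hS : S.Finite) {u : Set (M × M)}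
    (hu : IsPerspective G u) (n : ℕ) : IsPerspective G (shrink S u n) := by
  induction n with
  | zero => exact hu
  | succ n ih =>
    intro β
    refine (hS.biUnion fun s _ =>
      (ih β).preimage (f := fun g : G => s * g) (mul_right_injective s).injOn).subset ?_
    intro g hg
    have : ∃ s ∈ S, s • g • β ∉ shrink S u n := by
      by_contra! h
      exact hg h
    obtain ⟨s, hs, h⟩ := this
    refine mem_biUnion hs ?_
    change (s * g) • β ∉ _
    rwa [mul_smul]

lemma dist_smul_smul {Γ : SimpleGraph M} (hΓ : Γ.Connected)
    (hinv : ∀ (g : G) (x y : M), Γ.Adj x y → Γ.Adj (g • x) (g • y)) (g : G) (x y : M) :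
    Γ.dist (g • x) (g • y) = Γ.dist x y := by
  have key : ∀ (g : G) x y, Γ.dist (g • x) (g • y) ≤ Γ.dist x y := by
    intro g x y
    obtain ⟨w, hw⟩ := hΓ.exists_walk_length_eq_dist x y
    let f : Γ →g Γ := ⟨fun x => g • x, fun h => hinv g _ _ h⟩
    rw [← hw, ← w.length_map f]
    exact SimpleGraph.dist_le _
  refine (key g x y).antisymm ?_
  simpa using key g⁻¹ (g • x) (g • y)

/-- A perspective divider has the visibility property: a finite set of edges blocks the view
outside it. -/
lemma IsDivider.exists_isVisibleOff {Γ : SimpleGraph M} (hΓ : Γ.Connected)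
    (hinv : ∀ (g : G) (x y : M), Γ.Adj x y → Γ.Adj (g • x) (g • y)) {P : Set (M × M)}
    (hP : P.Finite) (hE : ∀ x y, Γ.Adj x y → ∃ e ∈ P, ∃ g : G, (x, y) = g • e)
    {u : Set (M × M)} (hu : IsDivider G u) (hpersp : IsPerspective G u) :
    ∃ A : Set (M × M), A.Finite ∧ IsVisibleOff Γ u A := by
  obtain ⟨S, hS, h1, hcomp⟩ := hu.exists_shrink_comp
  obtain ⟨o⟩ := hΓ.nonempty
  obtain ⟨C₀, hC₀⟩ : ∃ C₀ : ℕ, ∀ x y, Γ.Adj x y → (x, y) ∉ u → Γ.dist o x ≤ C₀ := by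
    obtain ⟨C₀, h⟩ := ((hpersp.finite_edges hP hE).image fun e => Γ.dist o e.1).bddAbove
    exact ⟨C₀, fun x y hxy hn => h ⟨(x, y), ⟨hxy, hn⟩, rfl⟩⟩
  obtain ⟨C, hC⟩ : ∃ C : ℕ, ∀ s ∈ S, Γ.dist (s • o) o ≤ C := by
    obtain ⟨C, h⟩ := (hS.image fun s => Γ.dist (s • o) o).bddAbove
    exact ⟨C, fun s hs => h ⟨s, hs, rfl⟩⟩
  -- An edge outside level `n + 1` is moved by some `s ∈ S` to one outside level `n`, and `s`
  -- displaces `o` by at most `C`.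
  have hlin : ∀ n x y, Γ.Adj x y → (x, y) ∉ shrink S u n → Γ.dist o x ≤ C * n + C₀ := by
    intro n
    induction n with
    | zero => exact fun x y hxy hn => by simpa using hC₀ x y hxy hn
    | succ n ih =>
      intro x y hxy hn
      have : ∃ s ∈ S, (s • x, s • y) ∉ shrink S u n := by
        by_contra! h
        exact hn h
      obtain ⟨s, hs, h⟩ := this
      have h2 := ih _ _ (hinv s x y hxy) h
      have h3 := hC s hs
      have h4 := hΓ.dist_triangle (u := s • o) (v := o) (w := s • x)
      rw [dist_smul_smul hΓ hinv] at h4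
      rw [mul_add, mul_one]
      omega
  obtain ⟨N, hN⟩ := exists_isVisibleOff_of_linear (Γ := Γ) (u := shrink S u)
    (shrink_succ_subset h1 u) (shrink_refl hu.refl) (shrink_comp hcomp) (2 * C) (2 * C₀)
    (fun n x y x' y' h h' hn hn' => by
      have h1 := hlin n x y h hn
      have h2 := hlin n x' y' h' hn'
      have h3 := hΓ.dist_triangle (u := x) (v := o) (w := x')
      rw [Γ.dist_comm (u := x) (v := o)] at h3
      rw [mul_assoc]
      omega)
  exact ⟨_, (isPerspective_shrink hS hpersp N).finite_edges hP hE, hN⟩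

lemma IsVisibleOff.smul {Γ : SimpleGraph M} (hΓ : Γ.Connected)
    (hinv : ∀ (g : G) (x y : M), Γ.Adj x y → Γ.Adj (g • x) (g • y)) {v A : Set (M × M)}
    (h : IsVisibleOff Γ v A) (g : G) : IsVisibleOff Γ (g • v) (g • A) := by
  intro p a b hab hp hA
  rw [mem_smul_rel]
  refine h (fun i => g⁻¹ • p i) a b hab (fun i j hi hij hj => ?_) fun i hi hib hmem => ?_
  · rw [dist_smul_smul hΓ hinv]
    exact hp i j hi hij hj
  · exact hA i hi hib (mem_smul_rel.2 hmem)

lemma IsVisibleOff.biInter {Γ : SimpleGraph M} {ι : Type*} {I : Set ι} {v A : ι → Set (M × M)}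
    (h : ∀ i ∈ I, IsVisibleOff Γ (v i) (A i)) :
    IsVisibleOff Γ (⋂ i ∈ I, v i) (⋃ i ∈ I, A i) := fun p a b hab hp hA =>
  mem_iInter₂.2 fun i hi => h i hi p a b hab hp fun j hj hjb hmem =>
    hA j hj hjb (mem_biUnion hi hmem)

lemma IsVisibleOff.mono {Γ : SimpleGraph M} {v v' A : Set (M × M)} (h : IsVisibleOff Γ v A)
    (hv : v ⊆ v') : IsVisibleOff Γ v' A :=
  fun p a b hab hp hA => hv (h p a b hab hp hA)

lemma IsPerspective.smul {u : Set (M × M)} (hu : IsPerspective G u) (g : G) :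
    IsPerspective G (g • u) := fun β => by
  refine ((hu β).preimage (f := fun h : G => g⁻¹ * h) (mul_right_injective g⁻¹).injOn).subset ?_
  intro h hh
  change (g⁻¹ * h) • β ∉ u
  rw [mul_smul, ← mem_smul_set_iff_inv_smul_mem]
  exact hh

lemma IsPerspective.biInter {ι : Type*} {I : Set ι} (hI : I.Finite) {v : ι → Set (M × M)}
    (h : ∀ i ∈ I, IsPerspective G (v i)) : IsPerspective G (⋂ i ∈ I, v i) := fun β => by
  refine (hI.biUnion fun i hi => h i hi β).subset fun g hg => ?_
  simpa using hg

lemma IsPerspective.mono {u v : Set (M × M)} (hu : IsPerspective G u) (huv : u ⊆ v) :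
    IsPerspective G v := fun β => (hu β).subset fun _ hg hgu => hg (huv hgu)

end Dividers

/-! ### Consequences of visibility for the uniformity -/

section Visibility

variable {G M : Type*} [Group G] [MulAction G M] [UniformSpace M]

lemma mem_uniformity_iff_of_eq_iInf {u : Set (M × M)} (h : 𝓤 M = ⨅ g : G, 𝓟 (g • u))
    {v : Set (M × M)} : v ∈ 𝓤 M ↔ ∃ I : Set G, I.Finite ∧ ⋂ g ∈ I, g • u ⊆ v := by
  rw [h]
  exact (hasBasis_iInf_principal_finite _).mem_iff

lemma uniformContinuousConstSMul_of_eq_iInf {u : Set (M × M)}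
    (h : 𝓤 M = ⨅ g : G, 𝓟 (g • u)) : UniformContinuousConstSMul G M := by
  refine ⟨fun c => ?_⟩
  change Tendsto _ (𝓤 M) (𝓤 M)
  conv_rhs => rw [h]
  refine tendsto_iInf.2 fun g => tendsto_principal.2 ?_
  have : (c⁻¹ * g) • u ∈ 𝓤 M := by
    rw [h]
    exact mem_iInf_of_mem _ (mem_principal_self _)
  filter_upwards [this] with e he
  obtain ⟨x, y⟩ := e
  rw [mem_smul_rel] at he ⊢
  simpa [mul_smul] using he

lemma isPerspective_of_mem_uniformity {u : Set (M × M)} (h : 𝓤 M = ⨅ g : G, 𝓟 (g • u))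
    (hu : IsPerspective G u) {v : Set (M × M)} (hv : v ∈ 𝓤 M) : IsPerspective G v := by
  obtain ⟨I, hI, hsub⟩ := (mem_uniformity_iff_of_eq_iInf h).1 hv
  exact (IsPerspective.biInter hI fun g _ => hu.smul g).mono hsub

/-- The graph `Γ` is seen properly from the uniformity: outside every entourage, the view is
blocked by finitely many edges. -/
def HasVisibility (Γ : SimpleGraph M) : Prop :=
  ∀ v ∈ 𝓤 M, ∃ A : Set (M × M), A.Finite ∧ IsVisibleOff Γ v A

lemma IsDivider.hasVisibility {Γ : SimpleGraph M} (hΓ : Γ.Connected)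
    (hinv : ∀ (g : G) (x y : M), Γ.Adj x y → Γ.Adj (g • x) (g • y)) {P : Set (M × M)}
    (hP : P.Finite) (hE : ∀ x y, Γ.Adj x y → ∃ e ∈ P, ∃ g : G, (x, y) = g • e)
    {u : Set (M × M)} (hu : IsDivider G u) (hpersp : IsPerspective G u)
    (h : 𝓤 M = ⨅ g : G, 𝓟 (g • u)) : HasVisibility Γ := by
  intro v hv
  obtain ⟨I, hI, hsub⟩ := (mem_uniformity_iff_of_eq_iInf h).1 hv
  obtain ⟨A, hA, hvis⟩ := hu.exists_isVisibleOff hΓ hinv hP hE hpersp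
  exact ⟨⋃ g ∈ I, g • A, hI.biUnion fun g _ => hA.smul_set,
    (IsVisibleOff.biInter fun g _ => hvis.smul hΓ hinv g).mono hsub⟩

/-- A geodesic from `x` to `o`, stopped at the first blocking edge, ends in a fixed finite set,
which is therefore a net. -/
lemma HasVisibility.totallyBounded {Γ : SimpleGraph M} (hΓ : Γ.Connected)
    (hvis : HasVisibility Γ) : TotallyBounded (univ : Set M) := by
  intro d hd
  obtain ⟨A, hA, hv⟩ := hvis d hd
  obtain ⟨o⟩ := hΓ.nonempty
  refine ⟨insert o (Prod.fst '' A), (hA.image _).insert o, fun x _ => ?_⟩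
  obtain ⟨p, c, hp, rfl, hc, havoid⟩ := exists_isGeodesicOn_avoiding hΓ A x o
  exact mem_biUnion hc (hv p 0 c (Nat.zero_le c) hp fun i _ hi => havoid i hi)

lemma compactSpace_completion (h : TotallyBounded (univ : Set M)) :
    CompactSpace (UniformSpace.Completion M) := by
  have h1 := (h.image (UniformSpace.Completion.uniformContinuous_coe M)).closure
  rw [image_univ, UniformSpace.Completion.denseRange_coe.closure_range] at h1
  exact isCompact_univ_iff.1
    (isCompact_iff_totallyBounded_isComplete.2 ⟨h1, completeSpace_iff_isComplete_univ.1 inferInstance⟩)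

/-- The convergence property of the action, on the dense subset. -/
lemma HasVisibility.finite_not_convergence {Γ : SimpleGraph M} (hΓ : Γ.Connected)
    (hinv : ∀ (g : G) (x y : M), Γ.Adj x y → Γ.Adj (g • x) (g • y))
    (hvis : HasVisibility Γ) (hpersp : ∀ v ∈ 𝓤 M, IsPerspective G v) {v w : Set (M × M)}
    (hv : v ∈ 𝓤 M) (hw : w ∈ 𝓤 M) (o : M) :
    {g : G | ¬ ∀ x : M, (g • x, g • o) ∈ v ∨ (x, g⁻¹ • o) ∈ w}.Finite := by
  obtain ⟨v₁, hv₁, hvv⟩ := comp_mem_uniformity_sets hv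
  obtain ⟨w₁, hw₁, hww⟩ := comp_mem_uniformity_sets hw
  obtain ⟨A, hA, hAvis⟩ := hvis w₁ hw₁
  obtain ⟨B, hB, hBvis⟩ := hvis v₁ hv₁
  have h1 : (⋃ y ∈ insert o (Prod.fst '' A), {g : G | g • (y, o) ∉ v₁}).Finite :=
    ((hA.image _).insert o).biUnion fun y _ => hpersp v₁ hv₁ _
  have h2 : (⋃ b ∈ Prod.fst '' B, {g : G | g⁻¹ • (b, o) ∉ w₁}).Finite :=
    (hB.image _).biUnion fun b _ =>
      (hpersp w₁ hw₁ (b, o)).preimage (f := fun g : G => g⁻¹) inv_injective.injOn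
  refine (h1.union h2).subset fun g hg => ?_
  by_contra hnot
  simp only [mem_union, not_or, mem_iUnion, mem_ofPred_eq, exists_prop, not_exists, not_and,
    not_not] at hnot
  obtain ⟨hg1, hg2⟩ := hnot
  refine hg fun x => ?_
  obtain ⟨p, c, hp, rfl, hc, havoid⟩ := exists_isGeodesicOn_avoiding hΓ A x o
  by_cases hgp : (g • p 0, g • p c) ∈ v₁
  · exact Or.inl (hvv ⟨_, hgp, hg1 _ hc⟩)
  · right
    -- The translated geodesic is not small, so it crosses an edge of `B`. Pulled back by `g⁻¹`, the
    -- start of that edge is close to `g⁻¹ • o`, and also to `x` since the original geodesic avoids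
    -- `A`.
    have : ∃ i < c, (g • p i, g • p (i + 1)) ∈ B := by
      by_contra! hno
      refine hgp (hBvis (fun i => g • p i) 0 c (Nat.zero_le c) (fun i j hi hij hj => ?_)
        fun i _ hi => hno i hi)
      rw [dist_smul_smul hΓ hinv]
      exact hp i j hi hij hj
    obtain ⟨i, hic, hi⟩ := this
    have h3 := hg2 (g • p i) ⟨_, hi, rfl⟩
    rw [Prod.smul_mk, inv_smul_smul] at h3
    exact hww ⟨p i, hAvis p 0 i (Nat.zero_le i) (hp.mono le_rfl hic.le)
      fun j _ hj => havoid j (hj.trans hic), h3⟩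

end Visibility

/-! ### Dynamical consequences of the convergence property -/

section Dynamics

variable {G T : Type*} [Group G] [MulAction G T] [UniformSpace T]

/-- The convergence property of the action of `G` on `T`, seen from a base point `o`: almost
all elements `g` of `G` map the complement of a small neighbourhood of `g⁻¹ • o` into a small
neighbourhood of `g • o`. -/
def ConvergesAt (G : Type*) {T : Type*} [Group G] [MulAction G T] [UniformSpace T] (o : T) :
    Prop :=
  ∀ v ∈ 𝓤 T, ∀ w ∈ 𝓤 T, {g : G | ¬ ∀ x : T, (g • x, g • o) ∈ v ∨ (x, g⁻¹ • o) ∈ w}.Finite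

lemma exists_uniformity_separating [CompactSpace T] [T2Space T] {n : ℕ}
    {K : Set (distinctTuples G T n)} (hK : IsCompact K) :
    ∃ w ∈ 𝓤 T, ∀ t ∈ K, ∀ i j, i ≠ j → ((t : Fin n → T) i, (t : Fin n → T) j) ∉ w := by
  have key : ∀ i j : Fin n, i ≠ j →
      ((fun t : distinctTuples G T n => ((t : Fin n → T) i, (t : Fin n → T) j)) '' K)ᶜ ∈ 𝓤 T := by
    intro i j hij
    have hcont : Continuous
        fun t : distinctTuples G T n => ((t : Fin n → T) i, (t : Fin n → T) j) :=
      ((continuous_apply i).comp continuous_subtype_val).prodMk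
        ((continuous_apply j).comp continuous_subtype_val)
    rw [← nhdsSet_diagonal_eq_uniformity]
    refine (hK.image hcont).isClosed.isOpen_compl.mem_nhdsSet.2 ?_
    rintro ⟨x, y⟩ hxy ⟨t, -, ht⟩
    obtain ⟨h1, h2⟩ := Prod.mk.inj ht
    have hxy' : x = y := hxy
    exact hij (t.2 (h1.trans (hxy'.trans h2.symm)))
  refine ⟨⋂ i : Fin n, ⋂ j : Fin n, {e | i ≠ j → e ∈
    ((fun t : distinctTuples G T n => ((t : Fin n → T) i, (t : Fin n → T) j)) '' K)ᶜ}, ?_, ?_⟩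
  · refine iInter_mem.2 fun i => iInter_mem.2 fun j => ?_
    by_cases hij : i = j
    · simp [hij]
    · filter_upwards [key i j hij] with e he _ using he
  · intro t ht i j hij hmem
    exact mem_iInter.1 (mem_iInter.1 hmem i) j hij ⟨t, ht, rfl⟩

/-- For all but finitely many `g`, each of the three points is near `g⁻¹ • o` or has its image near
`g • o`. Each alternative can hold for at most one point of a uniformly separated triple. -/
lemma ConvergesAt.properlyDiscontinuousSMul [CompactSpace T] [T2Space T] {o : T}
    (h : ConvergesAt G o) : ProperlyDiscontinuousSMul G (distinctTuples G T 3) := by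
  refine ⟨fun {K L} hK hL => ?_⟩
  obtain ⟨w, hw, hKw⟩ := exists_uniformity_separating hK
  obtain ⟨v, hv, hLv⟩ := exists_uniformity_separating hL
  obtain ⟨w₁, hw₁, hsymm, hww⟩ := comp_symm_mem_uniformity_sets hw
  obtain ⟨v₁, hv₁, hsymm', hvv⟩ := comp_symm_mem_uniformity_sets hv
  refine (h v₁ hv₁ w₁ hw₁).subset ?_
  rintro g ⟨_, ⟨t, htK, rfl⟩, htL⟩ hg
  have hsepK : ∀ i j, i ≠ j → ((t : Fin 3 → T) i, g⁻¹ • o) ∈ w₁ →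
      ((t : Fin 3 → T) j, g⁻¹ • o) ∉ w₁ := fun i j hij hi hj =>
    hKw t htK i j hij (hww ⟨_, hi, SetRel.symm w₁ hj⟩)
  have hsepL : ∀ i j, i ≠ j → (g • (t : Fin 3 → T) i, g • o) ∈ v₁ →
      (g • (t : Fin 3 → T) j, g • o) ∉ v₁ := fun i j hij hi hj =>
    hLv _ htL i j hij (hvv ⟨_, hi, SetRel.symm v₁ hj⟩)
  have h0 := hg ((t : Fin 3 → T) 0)
  have h1 := hg ((t : Fin 3 → T) 1)
  have h2 := hg ((t : Fin 3 → T) 2)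
  have a01 := hsepK 0 1 (by decide)
  have a02 := hsepK 0 2 (by decide)
  have a12 := hsepK 1 2 (by decide)
  have b01 := hsepL 0 1 (by decide)
  have b02 := hsepL 0 2 (by decide)
  have b12 := hsepL 1 2 (by decide)
  tauto

/-- Points at which an orbit accumulates (with multiplicity) are limit points. -/
lemma ConvergesAt.mem_limitSet [CompactSpace T] {o a : T} (h : ConvergesAt G o)
    (ha : ∀ A ∈ 𝓝 a, {g : G | g • o ∈ A}.Infinite) : a ∈ limitSet G T := by
  set F : Filter G := cofinite ⊓ comap (fun g : G => g • o) (𝓝 a) with hF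
  have hmem : ∀ A ∈ 𝓝 a, {g : G | g • o ∈ A} ∈ F := fun A hA =>
    mem_inf_of_right (preimage_mem_comap hA)
  have : F.NeBot := by
    rw [hF, inf_comm, inf_neBot_iff]
    intro s hs s' hs'
    obtain ⟨A, hA, hAs⟩ := mem_comap.1 hs
    obtain ⟨g, hg, hg'⟩ := ((ha A hA).sdiff (mem_cofinite.1 hs')).nonempty
    exact ⟨g, hAs hg, not_not.1 hg'⟩
  -- Along `F`, `g` leaves finite sets while `g • o` tends to `a`; the repelling point is a cluster
  -- point of `g⁻¹ • o`.
  obtain ⟨r, -, hr⟩ := isCompact_univ (f := map (fun g : G => g⁻¹ • o) F) (by simp)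
  refine ⟨r, fun R hR A hA => ?_⟩
  obtain ⟨w, hw, hwR⟩ := UniformSpace.mem_nhds_iff.1 hR
  obtain ⟨v, hv, hvA⟩ := UniformSpace.mem_nhds_iff.1 hA
  obtain ⟨w₁, hw₁, hsymm, hww⟩ := comp_symm_mem_uniformity_sets hw
  obtain ⟨v₁, hv₁, hsymm', hvv⟩ := comp_symm_mem_uniformity_sets hv
  have hfreq : ∃ᶠ g in F, g⁻¹ • o ∈ UniformSpace.ball r w₁ :=
    (mapClusterPt_iff_frequently.1 hr) _ (UniformSpace.ball_mem_nhds r hw₁)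
  have hev : ∀ᶠ g in F, g • o ∈ UniformSpace.ball a v₁ :=
    hmem _ (UniformSpace.ball_mem_nhds a hv₁)
  have hconv : ∀ᶠ g : G in F, ∀ x : T, (g • x, g • o) ∈ v₁ ∨ (x, g⁻¹ • o) ∈ w₁ :=
    mem_inf_of_left (mem_cofinite.2 (h v₁ hv₁ w₁ hw₁))
  have hgood : ∃ᶠ g in F, ∀ x ∉ R, g • x ∈ A := by
    refine (hfreq.and_eventually (hev.and hconv)).mono ?_
    rintro g ⟨h1, h2, h3⟩ x hx
    rcases h3 x with h4 | h4
    · exact hvA (hvv ⟨_, h2, SetRel.symm v₁ h4⟩)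
    · exact absurd (hwR (hww ⟨_, h1, SetRel.symm w₁ h4⟩)) hx
  exact frequently_cofinite_iff_infinite.1 (hgood.filter_mono inf_le_left)

end Dynamics

/-! ### The action on the completion -/

section Completion

open UniformSpace

variable {G M : Type*} [Group G] [MulAction G M] [UniformSpace M]

lemma convergesAt_completion [UniformContinuousConstSMul G M] {Γ : SimpleGraph M}
    (hΓ : Γ.Connected) (hinv : ∀ (g : G) (x y : M), Γ.Adj x y → Γ.Adj (g • x) (g • y))
    (hvis : HasVisibility Γ) (hpersp : ∀ v ∈ 𝓤 M, IsPerspective G v) (o : M) :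
    ConvergesAt G (o : Completion M) := by
  intro v hv w hw
  obtain ⟨v₁, hv₁, hvc, hvv⟩ := mem_uniformity_isClosed hv
  obtain ⟨w₁, hw₁, hwc, hww⟩ := mem_uniformity_isClosed hw
  have hcoe := Completion.uniformContinuous_coe M
  refine (hvis.finite_not_convergence hΓ hinv hpersp (hcoe hv₁) (hcoe hw₁) o).subset ?_
  intro g hg hconv
  refine hg fun x => ?_
  have key : (g • x, g • (o : Completion M)) ∈ v₁ ∨ (x, g⁻¹ • (o : Completion M)) ∈ w₁ := by
    induction x using Completion.induction_on with
    | hp =>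
      refine IsClosed.union ?_ ?_
      · exact hvc.preimage ((continuous_const_smul g).prodMk continuous_const)
      · exact hwc.preimage (continuous_id.prodMk continuous_const)
    | ih x =>
      rw [← Completion.coe_smul, ← Completion.coe_smul, ← Completion.coe_smul]
      exact hconv x
  exact key.imp (fun h => hvv h) fun h => hww h

/-- `M` is dense and a finite union of orbits, so a boundary point is in the closure of one orbit.
It is not in that orbit, so infinitely many `g` bring the base point near it. -/
lemma boundary_subset_limitSet [UniformContinuousConstSMul G M]
    [CompactSpace (Completion M)]
    (hconv : ∀ o : M, ConvergesAt G (o : Completion M)) {V : Set M} (hV : V.Finite)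
    (hcov : ∀ x : M, ∃ o ∈ V, ∃ g : G, x = g • o) :
    boundary M ⊆ limitSet G (Completion M) := by
  intro a ha
  have hrange : range ((↑) : M → Completion M) ⊆
      ⋃ o ∈ V, range fun g : G => g • (o : Completion M) := by
    rintro _ ⟨x, rfl⟩
    obtain ⟨o, ho, g, rfl⟩ := hcov x
    exact mem_biUnion ho ⟨g, (Completion.coe_smul g o).symm⟩
  have hcl : a ∈ ⋃ o ∈ V, closure (range fun g : G => g • (o : Completion M)) := by
    rw [← hV.closure_biUnion]
    exact closure_mono hrange (Completion.denseRange_coe a)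
  obtain ⟨o, -, hao⟩ := mem_iUnion₂.1 hcl
  refine (hconv o).mem_limitSet fun A hA hfin => ?_
  have hclosed : IsClosed ((fun g : G => g • (o : Completion M)) ''
      {g : G | g • (o : Completion M) ∈ A}) := (hfin.image _).isClosed
  have hna : a ∉ (fun g : G => g • (o : Completion M)) ''
      {g : G | g • (o : Completion M) ∈ A} := by
    rintro ⟨g, -, rfl⟩
    exact ha ⟨g • o, Completion.coe_smul g o⟩
  obtain ⟨_, ⟨hx1, hx2⟩, g, rfl⟩ :=
    mem_closure_iff_nhds.1 hao _ (inter_mem hA (hclosed.isOpen_compl.mem_nhds hna))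
  exact hx2 ⟨g, hx1, rfl⟩

/-- Pairs of distinct points of the completion can be moved outside a given entourage contained
in the generating relation. -/
lemma exists_smul_notMem [UniformContinuousConstSMul G M] {u : Set (M × M)}
    (h : 𝓤 M = ⨅ g : G, 𝓟 (g • u)) {U : Set (Completion M × Completion M)} (hU : IsOpen U)
    (hUu : ∀ x y : M, ((x : Completion M), (y : Completion M)) ∈ U → (x, y) ∈ u)
    {x y : Completion M} (hxy : x ≠ y) : ∃ g : G, (g • x, g • y) ∉ U := by
  by_contra! hall
  obtain ⟨V, hV, hVxy⟩ : ∃ V ∈ 𝓤 (Completion M), (x, y) ∉ V := by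
    by_contra! hno
    exact hxy (eq_of_uniformity fun {V} hV => hno V hV)
  obtain ⟨V', hV', hVc, hVV⟩ := mem_uniformity_isClosed hV
  obtain ⟨I, hI, hsub⟩ := (mem_uniformity_iff_of_eq_iInf h).1
    (Completion.uniformContinuous_coe M hV')
  have hopen : IsOpen ((V' : Set (Completion M × Completion M))ᶜ ∩
      ⋂ g ∈ I, {e : Completion M × Completion M | (g⁻¹ • e.1, g⁻¹ • e.2) ∈ U}) := by
    refine hVc.isOpen_compl.inter (hI.isOpen_biInter fun g _ => hU.preimage ?_)
    exact (continuous_fst.const_smul g⁻¹).prodMk (continuous_snd.const_smul g⁻¹)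
  have hdense : DenseRange (Prod.map ((↑) : M → Completion M) ((↑) : M → Completion M)) :=
    Completion.denseRange_coe.prodMap Completion.denseRange_coe
  -- Finitely many translates of `U` already force pairs from `M` into `V'`; density supplies such a
  -- pair outside `V'`.
  obtain ⟨⟨m, m'⟩, hm1, hm2⟩ := hdense.exists_mem_open hopen
      ⟨(x, y), fun hmem => hVxy (hVV hmem), mem_iInter₂.2 fun g _ => hall g⁻¹⟩
  refine hm1 (hsub (mem_iInter₂.2 fun g hg => mem_smul_rel.2 (hUu _ _ ?_)))
  rw [Completion.coe_smul, Completion.coe_smul]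
  exact mem_iInter₂.1 hm2 g hg

lemma cocompact_on_pairs [UniformContinuousConstSMul G M] [CompactSpace (Completion M)]
    {u : Set (M × M)} (h : 𝓤 M = ⨅ g : G, 𝓟 (g • u)) :
    ∃ K : Set (distinctTuples G (Completion M) 2), IsCompact K ∧ ⋃ g : G, g • K = univ := by
  have hu : u ∈ 𝓤 M := by
    rw [h]
    exact mem_iInf_of_mem 1 (by simp)
  rw [← Completion.comap_coe_eq_uniformity] at hu
  obtain ⟨U₀, hU₀, hsub⟩ := mem_comap.1 hu
  obtain ⟨U, hU, hUo, hUU⟩ : ∃ U : Set (Completion M × Completion M),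
      U ∈ 𝓤 (Completion M) ∧ IsOpen U ∧ U ⊆ U₀ :=
    ⟨interior U₀, interior_mem_uniformity hU₀, isOpen_interior, interior_subset⟩
  -- `U` contains the diagonal, so the pairs outside it are automatically distinct and form a closed
  -- subset of the full compact square.
  refine ⟨{t | ((t : Fin 2 → Completion M) 0, (t : Fin 2 → Completion M) 1) ∉ U}, ?_, ?_⟩
  · rw [Subtype.isCompact_iff]
    have hc : Continuous fun t : Fin 2 → Completion M => (t 0, t 1) := by fun_prop
    have : IsClosed {t : Fin 2 → Completion M | (t 0, t 1) ∉ U} :=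
      hUo.isClosed_compl.preimage hc
    convert this.isCompact using 1
    ext t
    refine ⟨?_, fun ht => ⟨⟨t, ?_⟩, ht, rfl⟩⟩
    · rintro ⟨t, ht, rfl⟩
      exact ht
    · have h01 : t 0 ≠ t 1 := fun h01 => ht (by rw [h01]; exact refl_mem_uniformity hU)
      intro i j hij
      fin_cases i <;> fin_cases j <;> first | rfl | exact absurd hij h01 | exact absurd hij.symm h01
  · refine eq_univ_of_forall fun t => mem_iUnion.2 ?_
    have h01 : (t : Fin 2 → Completion M) 0 ≠ (t : Fin 2 → Completion M) 1 := fun h01 =>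
      absurd (t.2 h01) (by decide)
    obtain ⟨g, hg⟩ := exists_smul_notMem h hUo (fun x y hxy => hsub (hUU hxy)) h01
    exact ⟨g⁻¹, mem_smul_set_iff_inv_smul_mem.2 (by rw [inv_inv]; exact hg)⟩

end Completion

end RelHyp

theorem mainTheorem5 {G M : Type*} [Group G] [MulAction G M] [UniformSpace M]
    (hM : RelHyp.IsConnectedGSet G M) (hU : RelHyp.IsRelativeHyperbolicity G M) :
    ∃ _ : UniformContinuousConstSMul G M,
      RelHyp.IsRelativelyHyperbolicAction G (UniformSpace.Completion M) := by
  obtain ⟨Γ, hΓ, hinv, hedges⟩ := hM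
  obtain ⟨P, hP, hE⟩ := RelHyp.exists_finite_orbit_reps hedges
  obtain ⟨u, hdiv, hpersp, h⟩ := hU.exists_divider
  have hvis : RelHyp.HasVisibility Γ := hdiv.hasVisibility hΓ hinv hP hE hpersp h
  have hact := RelHyp.uniformContinuousConstSMul_of_eq_iInf h
  have hcompact := RelHyp.compactSpace_completion (hvis.totallyBounded hΓ)
  have hconv := RelHyp.convergesAt_completion hΓ hinv hvis
    fun v hv => RelHyp.isPerspective_of_mem_uniformity h hpersp hv
  obtain ⟨V, hV, hcov⟩ := RelHyp.exists_finite_vertex_reps hΓ hP hE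
  obtain ⟨o⟩ := hΓ.nonempty
  exact ⟨hact, hcompact, inferInstance, inferInstance, (hconv o).properlyDiscontinuousSMul,
    RelHyp.cocompact_on_pairs h,
    hU.not_parabolic.mono (RelHyp.boundary_subset_limitSet hconv hV hcov)⟩
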